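/- Let $n\ge 0$, let $\lambda=(\lambda_1\ge\lambda_2\ge\cdots)$ be a partition of length $\ell(\lambda)\le n$, let $\delta=(n,n-1,\ldots,1)$, and let $\mu=\lambda+\delta$, i.e. $\mu_i=\lambda_i+n-i+1$ for $1\le i\le n$, a strict partition of length $n$. Let $m$ be an integer with $m\ge n$ and $m\ge\mu_1$. Let $x=(x_1,\ldots,x_n)$ and $y=(y_1,\ldots,y_n)$ be elements of a commutative ring. The Schur function is $s_\lambda(x)=\sum_T \prod_{k=1}^n x_k^{w_k(T)}$, summed over all semistandard tableaux $T$ of shape $\lambda$ with entries in $\{1,\ldots,n\}$ (rows weakly increasing, columns strictly increasing), where $w_k(T)$ is the number of entries of $T$ equal to $k$. The set $\mathcal A^\mu(n)$ of $\mu$-alternating sign matrices consists of the $n\times m$ integer matrices $A=(a_{iq})$ such that (1) $a_{iq}\in\{-1,0,1\}$ for all $i,q$; (2) $\sum_{q=p}^m a_{iq}\in\{0,1\}$ for $1\le i\le n$, $1\le p\le m$; (3) $\sum_{i=1}^{j} a_{iq}\in\{0,1\}$ for $1\le j\le n$, $1\le q\le m$; (4) $\sum_{q=1}^m a_{iq}=1$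 for $1\le i\le n$; (5) for $1\le q\le m$, $\sum_{i=1}^n a_{iq}=1$ if $q=\mu_j$ for some $j$, and $\sum_{i=1}^n a_{iq}=0$ otherwise. The compass point matrix $CM(A)$ is obtained from $A$ by replacing each entry by its square-ice vertex type, where rows are listed from top to bottom: an entry $1$ is replaced by $WE$, an entry $-1$ by $NS$, and an entry $0$ by one of $NE,SE,NW,SW$, where the second letter is $E$ if the nearest nonzero entry to its right in the same row exists and equals $1$, and is $W$ otherwise, and the first letter is $S$ if the nearest nonzero entry above it in the same column exists and equals $1$, and is $N$ otherwise. Let $NE_k(A)$, $SE_k(A)$, $NS_k(A)$ be the numbers of entries $NE$, $SE$, $NS$ in the $k$th row of $CM(A)$. Then $$\prod_{1\le i<j\le n}(x_i+y_j)\; s_\lambda(x)=\sum_{A\in\mathcal A^\mu(n)}\ \prod_{k=1}^n x_k^{NE_k(A)}\,y_k^{SE_k(A)}\,(x_k+y_k)^{NS_k(A)}.$$ -/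

import Mathlib

/-- `shiftedParts lam n` is the sequence `μ = λ + δ` with `δ = (n, n-1, …, 1)`; the index `i : Fin n`
stands for the `(i+1)`-st part, so that `μ_{i+1} = λ_{i+1} + (n - i)`. -/
def shiftedParts (lam : YoungDiagram) (n : ℕ) : Fin n → ℕ :=
  fun i => lam.rowLen i + (n - i)

/-- The set `𝒯^λ(n)` of semistandard tableaux of shape `λ` with entries in an alphabet of `n`
letters. The letters are numbered `0, 1, …, n-1`. -/
def boundedTableaux (lam : YoungDiagram) (n : ℕ) : Set (SemistandardYoungTableau lam) :=
  {T | ∀ c ∈ lam.cells, T c.1 c.2 < n}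

theorem boundedTableaux_finite (lam : YoungDiagram) (n : ℕ) : (boundedTableaux lam n).Finite := by
  let f : boundedTableaux lam n → (lam.cells → Fin n) :=
    fun T c => ⟨T.1 c.1.1 c.1.2, T.2 c.1 c.2⟩
  have hf : Function.Injective f := by
    intro S T h
    apply Subtype.ext
    apply SemistandardYoungTableau.ext
    intro i j
    by_cases hc : (i, j) ∈ lam
    · have := congrFun h ⟨(i, j), (YoungDiagram.mem_cells _).2 hc⟩
      exact congrArg Fin.val this
    · rw [S.1.zeros hc, T.1.zeros hc]
  exact Set.finite_coe_iff.mp (Finite.of_injective f hf)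

/-- The number `w_k` of times that the letter `k` appears in the tableau `T`. -/
def tableauWeight {lam : YoungDiagram} (T : SemistandardYoungTableau lam) (k : ℕ) : ℕ :=
  (lam.cells.filter (fun c => T c.1 c.2 = k)).card

/-- The Schur function `s_λ(x_1, …, x_n) = ∑_{T ∈ 𝒯^λ(n)} x^{wgt(T)}`. -/
noncomputable def schurFunction {R : Type*} [CommRing R] (lam : YoungDiagram) {n : ℕ}
    (x : Fin n → R) : R :=
  ∑ T ∈ (boundedTableaux_finite lam n).toFinset, ∏ k : Fin n, x k ^ tableauWeight T k

/-- `A` is a `μ`-alternating sign matrix with `n` rows and `m` columns, rows being listed from top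
to bottom; the column with index `q : Fin m` carries the label `q + 1`. -/
structure IsMuASM {n m : ℕ} (mu : Fin n → ℕ) (A : Matrix (Fin n) (Fin m) ℤ) : Prop where
  entry_mem : ∀ i q, A i q = -1 ∨ A i q = 0 ∨ A i q = 1
  row_partial : ∀ i p, ∑ q ∈ Finset.Ici p, A i q = 0 ∨ ∑ q ∈ Finset.Ici p, A i q = 1
  col_partial : ∀ j q, ∑ i ∈ Finset.Iic j, A i q = 0 ∨ ∑ i ∈ Finset.Iic j, A i q = 1
  row_sum : ∀ i, ∑ q, A i q = 1
  col_sum_part : ∀ q : Fin m, (∃ j, mu j = (q : ℕ) + 1) → ∑ i, A i q = 1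
  col_sum_not_part : ∀ q : Fin m, (¬ ∃ j, mu j = (q : ℕ) + 1) → ∑ i, A i q = 0

theorem muASM_finite {n : ℕ} (m : ℕ) (mu : Fin n → ℕ) :
    {A : Matrix (Fin n) (Fin m) ℤ | IsMuASM mu A}.Finite := by
  have h : (Set.pi Set.univ fun _ : Fin n => Set.pi Set.univ fun _ : Fin m =>
      ({-1, 0, 1} : Set ℤ)).Finite :=
    Set.Finite.pi fun _ => Set.Finite.pi fun _ => Set.toFinite _
  refine h.subset ?_
  intro A hA i _ q _
  simpa using hA.entry_mem i q

/-- The set `𝒜^μ(n)` of `μ`-alternating sign matrices of size `n × m`. -/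
noncomputable def muASM {n : ℕ} (m : ℕ) (mu : Fin n → ℕ) : Finset (Matrix (Fin n) (Fin m) ℤ) :=
  (muASM_finite m mu).toFinset

/-- The six vertex types of square ice. -/
inductive Compass where
  | WE | NS | NE | SE | NW | SW
  deriving DecidableEq

/-- The entry at `(i, q)` has a nonzero neighbour to its right, and the nearest one is `1`.
In the square ice graph of an alternating sign matrix, this says for a zero entry that the
horizontal edges at the vertex point east. -/
def NearestRightIsOne {n m : ℕ} (A : Matrix (Fin n) (Fin m) ℤ) (i : Fin n) (q : Fin m) : Prop :=
  ∃ p : Fin m, q < p ∧ A i p = 1 ∧ ∀ r : Fin m, q < r → r < p → A i r = 0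

/-- The entry at `(i, q)` has a nonzero neighbour above it, and the nearest one is `1`.
In the square ice graph of a `μ`-alternating sign matrix (all edges on the upper boundary point
north), this says for a zero entry that the vertical edges at the vertex point south. -/
def NearestAboveIsOne {n m : ℕ} (A : Matrix (Fin n) (Fin m) ℤ) (i : Fin n) (q : Fin m) : Prop :=
  ∃ j : Fin n, j < i ∧ A j q = 1 ∧ ∀ k : Fin n, j < k → k < i → A k q = 0

instance {n m : ℕ} (A : Matrix (Fin n) (Fin m) ℤ) (i : Fin n) (q : Fin m) :
    Decidable (NearestRightIsOne A i q) := by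
  unfold NearestRightIsOne
  infer_instance

instance {n m : ℕ} (A : Matrix (Fin n) (Fin m) ℤ) (i : Fin n) (q : Fin m) :
    Decidable (NearestAboveIsOne A i q) := by
  unfold NearestAboveIsOne
  infer_instance

/-- The compass point matrix `CM(A)`. An entry `1` is of type `WE` (horizontal edges pointing in),
an entry `-1` of type `NS` (vertical edges pointing in), and a zero is named after the two
directions in which the edges through its vertex point. -/
def compassMatrix {n m : ℕ} (A : Matrix (Fin n) (Fin m) ℤ) : Matrix (Fin n) (Fin m) Compass :=
  fun i q =>
    if A i q = 1 then Compass.WE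
    else if A i q = -1 then Compass.NS
    else if NearestRightIsOne A i q then
      (if NearestAboveIsOne A i q then Compass.SE else Compass.NE)
    else
      (if NearestAboveIsOne A i q then Compass.SW else Compass.NW)

/-- The number of entries of type `c` in the `k`-th row of the compass point matrix of `A`. -/
def compassCount {n m : ℕ} (c : Compass) (A : Matrix (Fin n) (Fin m) ℤ) (k : Fin n) : ℕ :=
  (Finset.univ.filter (fun q : Fin m => compassMatrix A k q = c)).card

/-! Both sides, multiplied by the Vandermonde product of the `x i`, become `∏_{i<j} (x i + y j)`
times the alternant `det (x i ^ b j)`, where `b j = λ_j + n - 1 - j` are the zero-based column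
positions. For the left side this is the bialternant formula `altVandermonde_mul_schurFunction`, for
the right side `altVandermonde_mul_asmSum`.

Both are inductions on `n` that peel off the last variable and share one engine,
`prod_sub_mul_sum_det`. Column operations on the alternant clear the last row up to one entry and
leave columns `z ^ b j - x_n ^ (b j - b (j+1)) * z ^ b (j+1)`. Dividing each by `z - x_n` gives a
geometric sum, and multilinearity expands the determinant into smaller alternants whose exponents
interlace with `b`.

On the combinatorial side the same interlacing appears. Removing the largest letter from a tableau
removes a horizontal strip (`schurFunction_succ`). Deleting the last row of an alternating sign
matrix leaves one whose column set `c` interlaces with `b` (`asmSum_succ`), and the vertex weights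
of that row turn the geometric sum into its multiple by `z + y_n` (`sum_gapWeight_mul_pow`), which
yields the factors `x i + y_n`.

The Vandermonde product is cancelled over a polynomial ring, and the identity is then specialised to
`R`. -/

/-! ### Alternants and the removal of one variable. -/

open Finset in
theorem Matrix.det_sum_columns {R α : Type*} [CommRing R] [DecidableEq α] {n : ℕ}
    (s : Fin n → Finset α) (g : Fin n → α → Fin n → R) :
    (Matrix.of fun i j => ∑ c ∈ s j, g j c i).det =
      ∑ c ∈ Fintype.piFinset s, (Matrix.of fun i j => g j (c j) i).det := by
  have h := (Matrix.detRowAlternating (n := Fin n) (R := R)).toMultilinearMap.map_sum_finset g s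
  rw [← Matrix.det_transpose]
  have e : (Matrix.of fun i j => ∑ c ∈ s j, g j c i).transpose = fun j => ∑ c ∈ s j, g j c := by
    ext j i
    simp [Finset.sum_apply]
  rw [e]
  refine h.trans (Finset.sum_congr rfl fun c _ => ?_)
  rw [← Matrix.det_transpose]
  rfl

/-- Subtracting from each column the multiple of the next one that kills its last entry leaves a
last row with a single entry, along which the determinant is expanded. Antitonicity makes the
truncated subtraction of exponents exact. -/
theorem Matrix.det_pow_eq_mul_det_sub {R : Type*} [CommRing R] {n : ℕ} (x : Fin (n + 1) → R)
    (b : Fin (n + 1) → ℕ) (hb : Antitone b) :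
    (Matrix.of fun i j => x i ^ b j).det = x (Fin.last n) ^ b (Fin.last n) *
      (Matrix.of fun i j : Fin n => x i.castSucc ^ b j.castSucc -
        x (Fin.last n) ^ (b j.castSucc - b j.succ) * x i.castSucc ^ b j.succ).det := by
  set z := x (Fin.last n) with hz
  obtain ⟨B, hBl, hBc⟩ : ∃ B : Matrix (Fin (n + 1)) (Fin (n + 1)) R,
      (∀ i, B i (Fin.last n) = x i ^ b (Fin.last n)) ∧ ∀ i (j : Fin n), B i j.castSucc =
        x i ^ b j.castSucc - z ^ (b j.castSucc - b j.succ) * x i ^ b j.succ :=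
    ⟨fun i j => Fin.lastCases (motive := fun _ => R) (x i ^ b (Fin.last n))
      (fun j => x i ^ b j.castSucc - z ^ (b j.castSucc - b j.succ) * x i ^ b j.succ) j,
      by simp, by simp⟩
  have hAB : (Matrix.of fun i j => x i ^ b j).det = B.det := by
    -- The column-operation lemma uses the preceding column, whereas here the following one is
    -- subtracted; reversing the indices reconciles the two.
    rw [← Matrix.det_submatrix_equiv_self Fin.revPerm, ← Matrix.det_submatrix_equiv_self
      Fin.revPerm B]
    refine Matrix.det_eq_of_forall_col_eq_smul_add_pred
      (fun j => z ^ (b j.rev.castSucc - b j.rev.succ)) (fun i => ?_) (fun i j => ?_)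
    · simp [hBl]
    · simp [hBc, Fin.rev_succ, Fin.rev_castSucc]
  rw [hAB, Matrix.det_succ_row B (Fin.last n), Finset.sum_eq_single (Fin.last n)]
  · have h1 : B (Fin.last n) (Fin.last n) = z ^ b (Fin.last n) := by rw [hBl, hz]
    rw [h1, ← two_mul, pow_mul]
    simp only [even_two, Even.neg_pow, one_pow, one_mul]
    congr 2
    ext i j
    simp [hBc]
  · intro j _ hj
    obtain ⟨j, rfl⟩ := Fin.exists_castSucc_eq.2 hj
    have hle : b j.succ ≤ b j.castSucc := hb (Fin.castSucc_le_succ j)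
    have : B (Fin.last n) j.castSucc = 0 := by
      rw [hBc, ← hz, ← pow_add]
      rw [Nat.sub_add_cancel hle, sub_self]
    simp [this]
  · simp

/-- The Vandermonde product `∏_{i<j} (x_i - x_j)`. -/
def altVandermonde {R : Type*} [CommRing R] {n : ℕ} (x : Fin n → R) : R :=
  ∏ i : Fin n, ∏ j ∈ Finset.Ioi i, (x i - x j)

theorem Fin.prod_Ioi_castSucc {R : Type*} [CommMonoid R] {n : ℕ}
    (f : Fin (n + 1) → Fin (n + 1) → R) :
    ∏ i : Fin (n + 1), ∏ j ∈ Finset.Ioi i, f i j =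
      (∏ i : Fin n, f i.castSucc (Fin.last n)) *
        ∏ i : Fin n, ∏ j ∈ Finset.Ioi i, f i.castSucc j.castSucc := by
  have h (k : ℕ) (g : Fin k → Fin k → R) : ∏ i : Fin k, ∏ j ∈ Finset.Ioi i, g i j =
      ∏ i : Fin k, ∏ j : Fin k, if i < j then g i j else 1 := by
    refine Finset.prod_congr rfl fun i _ => ?_
    rw [← Finset.prod_filter]
    exact Finset.prod_congr (by ext; simp) fun _ _ => rfl
  rw [h, h, Fin.prod_univ_castSucc]
  simp [Fin.prod_univ_castSucc, Finset.prod_mul_distrib, Fin.castSucc_lt_last, mul_comm,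
    Fin.not_lt.2 (Fin.le_last _)]

theorem altVandermonde_succ {R : Type*} [CommRing R] {n : ℕ} (x : Fin (n + 1) → R) :
    altVandermonde x = (∏ i : Fin n, (x i.castSucc - x (Fin.last n))) *
      altVandermonde (fun i : Fin n => x i.castSucc) :=
  Fin.prod_Ioi_castSucc fun i j => x i - x j

theorem altVandermonde_ne_zero {R : Type*} [CommRing R] [IsDomain R] {n : ℕ} {x : Fin n → R}
    (hx : Function.Injective x) : altVandermonde x ≠ 0 := by
  refine Finset.prod_ne_zero_iff.2 fun i _ => Finset.prod_ne_zero_iff.2 fun j hj => ?_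
  exact sub_ne_zero.2 fun h => (Finset.mem_Ioi.1 hj).ne (hx h)

theorem sum_range_succ_mul_pow_mul_sub {R : Type*} [CommRing R] (z x : R) (d : ℕ) :
    (∑ e ∈ Finset.range d, z ^ e * x ^ (d - 1 - e)) * (z - x) = z ^ d - x ^ d :=
  (Commute.all z x).geom_sum₂_mul d

/-- If the column weights `w j c` satisfy a one-variable identity, then the weighted sum of
alternants over exponents interlacing with `b` is an alternant with one more variable. -/
theorem prod_sub_mul_sum_det {R : Type*} [CommRing R] {n : ℕ} (x : Fin (n + 1) → R)
    (b : Fin (n + 1) → ℕ) (hb : Antitone b) (s : Fin n → Finset ℕ) (w : Fin n → ℕ → R)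
    (e : Fin n → ℕ → ℕ) (f : R → R)
    (hw : ∀ j z, (∑ c ∈ s j, w j c * z ^ e j c) * (z - x (Fin.last n)) =
      f z * (z ^ b j.castSucc - x (Fin.last n) ^ (b j.castSucc - b j.succ) * z ^ b j.succ)) :
    (∏ i : Fin n, (x i.castSucc - x (Fin.last n))) * (∑ c ∈ Fintype.piFinset s,
      (x (Fin.last n) ^ b (Fin.last n) * ∏ j, w j (c j)) *
        (Matrix.of fun i j : Fin n => x i.castSucc ^ e j (c j)).det) =
      (∏ i : Fin n, f (x i.castSucc)) * (Matrix.of fun i j => x i ^ b j).det := by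
  have h1 : ∑ c ∈ Fintype.piFinset s, (x (Fin.last n) ^ b (Fin.last n) * ∏ j, w j (c j)) *
        (Matrix.of fun i j : Fin n => x i.castSucc ^ e j (c j)).det =
      x (Fin.last n) ^ b (Fin.last n) * (Matrix.of fun i j : Fin n =>
        ∑ c ∈ s j, w j c * x i.castSucc ^ e j c).det := by
    rw [Matrix.det_sum_columns s fun j c i => w j c * x i.castSucc ^ e j c, Finset.mul_sum]
    refine Finset.sum_congr rfl fun c _ => ?_
    rw [mul_assoc]
    congr 1
    exact (Matrix.det_mul_row (fun j => w j (c j))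
      (Matrix.of fun i j : Fin n => x i.castSucc ^ e j (c j))).symm
  rw [h1, Matrix.det_pow_eq_mul_det_sub x b hb, mul_left_comm, mul_left_comm (∏ i, f _)]
  congr 1
  -- The products over `i` are absorbed as row factors, after which the entries agree by `hw`.
  rw [← Matrix.det_mul_column, ← Matrix.det_mul_column]
  congr 1
  ext i j
  simp only [Matrix.of_apply]
  rw [mul_comm, hw]

/-! ### Column sets, counting functions and interlacing. -/

/-- The indicator function of the range of `b`. -/
noncomputable def rangeIndicator {n : ℕ} (b : Fin n → ℕ) (q : ℕ) : ℤ :=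
  open Classical in if ∃ j, b j = q then 1 else 0

theorem rangeIndicator_apply {n : ℕ} (b : Fin n → ℕ) (j : Fin n) : rangeIndicator b (b j) = 1 :=
  if_pos ⟨j, rfl⟩

theorem rangeIndicator_of_forall_ne {n : ℕ} {b : Fin n → ℕ} {q : ℕ} (h : ∀ j, b j ≠ q) :
    rangeIndicator b q = 0 :=
  if_neg fun ⟨j, hj⟩ => h j hj

theorem rangeIndicator_eq_sum {n : ℕ} {b : Fin n → ℕ} (hb : Function.Injective b) (q : ℕ) :
    rangeIndicator b q = ∑ j, if b j = q then 1 else 0 := by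
  by_cases h : ∃ j, b j = q
  · obtain ⟨j, rfl⟩ := h
    rw [rangeIndicator_apply, Finset.sum_eq_single j] <;> simp +contextual [hb.eq_iff]
  · rw [rangeIndicator, if_neg h]
    exact (Finset.sum_eq_zero fun j _ => if_neg fun hj => h ⟨j, hj⟩).symm

/-- The number of values of `b` that are at least `p`. -/
def countGE {n : ℕ} (b : Fin n → ℕ) (p : ℕ) : ℕ := (Finset.univ.filter fun j => p ≤ b j).card

theorem countGE_le {n : ℕ} (b : Fin n → ℕ) (p : ℕ) : countGE b p ≤ n := by
  simpa [countGE] using Finset.card_filter_le (Finset.univ : Finset (Fin n)) fun j => p ≤ b j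

/-- For antitone `b` the indices counted form an initial segment. -/
theorem lt_countGE_iff {n : ℕ} {b : Fin n → ℕ} (hb : Antitone b) (p : ℕ) (j : Fin n) :
    (j : ℕ) < countGE b p ↔ p ≤ b j := by
  constructor
  · intro h
    by_contra hp
    have : (Finset.univ.filter fun i => p ≤ b i) ⊆ Finset.Iio j := by
      intro i hi
      rw [Finset.mem_Iio]
      by_contra hij
      exact hp ((Finset.mem_filter.1 hi).2.trans (hb (not_lt.1 hij)))
    have := Finset.card_le_card this
    rw [Fin.card_Iio] at this
    exact absurd h (not_lt.2 this)
  · intro h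
    have : Finset.Iic j ⊆ (Finset.univ.filter fun i => p ≤ b i) := fun i hi =>
      Finset.mem_filter.2 ⟨Finset.mem_univ _, h.trans (hb (Finset.mem_Iic.1 hi))⟩
    have := Finset.card_le_card this
    rw [Fin.card_Iic] at this
    exact this

theorem sum_Ici_rangeIndicator {n m : ℕ} {b : Fin n → ℕ} (hb : Function.Injective b)
    (hbm : ∀ j, b j < m) (p : Fin m) :
    ∑ q ∈ Finset.Ici p, rangeIndicator b q = countGE b p := by
  simp_rw [rangeIndicator_eq_sum hb]
  rw [Finset.sum_comm, countGE, Finset.card_filter, Nat.cast_sum]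
  refine Finset.sum_congr rfl fun j _ => ?_
  have (q : Fin m) : b j = (q : ℕ) ↔ (⟨b j, hbm j⟩ : Fin m) = q := by
    rw [Fin.ext_iff]
  simp only [this, Finset.sum_ite_eq, Finset.mem_Ici, Fin.le_def]
  split_ifs <;> rfl

theorem sum_rangeIndicator {n m : ℕ} {b : Fin n → ℕ} (hb : Function.Injective b)
    (hbm : ∀ j, b j < m) : ∑ q : Fin m, rangeIndicator b q = n := by
  simp_rw [rangeIndicator_eq_sum hb]
  rw [Finset.sum_comm]
  have (j : Fin n) (q : Fin m) : b j = (q : ℕ) ↔ (⟨b j, hbm j⟩ : Fin m) = q := by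
    rw [Fin.ext_iff]
  simp [this]

/-- The sequence `c` interlaces with `b`: `b_0 ≥ c_0 ≥ b_1 ≥ c_1 ≥ ⋯ ≥ b_n`. -/
def Interlaces {n : ℕ} (b : Fin (n + 1) → ℕ) (c : Fin n → ℕ) : Prop :=
  ∀ j, b j.succ ≤ c j ∧ c j ≤ b j.castSucc

theorem Interlaces.countGE_le_countGE {n : ℕ} {b : Fin (n + 1) → ℕ} {c : Fin n → ℕ}
    (h : Interlaces b c) (hb : Antitone b) (hc : Antitone c) (p : ℕ) :
    countGE c p ≤ countGE b p ∧ countGE b p ≤ countGE c p + 1 := by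
  have h1 := countGE_le c p
  have h2 := countGE_le b p
  constructor
  · by_contra! hlt
    let j : Fin n := ⟨countGE b p, by omega⟩
    have := (lt_countGE_iff hb p j.castSucc).2
      (((lt_countGE_iff hc p j).1 hlt).trans (h j).2)
    exact lt_irrefl _ this
  · by_contra! hlt
    let j : Fin n := ⟨countGE c p, by omega⟩
    have := (lt_countGE_iff hc p j).2 (((lt_countGE_iff hb p j.succ).1 hlt).trans (h j).1)
    exact lt_irrefl _ this

/-- The two inequalities come from testing `p = b j.succ` and `p = c j`. The hypothesis `h` is what
the row partial sums of a last row provide. -/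
theorem interlaces_of_countGE {n m : ℕ} {b : Fin (n + 1) → ℕ} {c : Fin n → ℕ} (hb : Antitone b)
    (hc : Antitone c) (hbm : ∀ j, b j < m) (hcm : ∀ j, c j < m)
    (h : ∀ p < m, countGE c p ≤ countGE b p ∧ countGE b p ≤ countGE c p + 1) :
    Interlaces b c := by
  intro j
  constructor
  · have h1 := (lt_countGE_iff hb _ j.succ).2 le_rfl
    have h2 := (h _ (hbm j.succ)).2
    refine (lt_countGE_iff hc _ j).1 ?_
    rw [Fin.val_succ] at h1
    omega
  · exact (lt_countGE_iff hb _ j.castSucc).1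
      (((lt_countGE_iff hc _ j).2 le_rfl).trans_le (h _ (hcm j)).1)

/-! ### Vertex directions as partial sums. -/

section Nearest

variable {α : Type*} [LinearOrder α] [LocallyFiniteOrderTop α]

theorem sum_Ioi_eq_zero_or_one {f : α → ℤ}
    (h : ∀ p, ∑ q ∈ Finset.Ici p, f q = 0 ∨ ∑ q ∈ Finset.Ici p, f q = 1) (p : α) :
    ∑ q ∈ Finset.Ioi p, f q = 0 ∨ ∑ q ∈ Finset.Ioi p, f q = 1 := by
  rcases (Finset.Ioi p).eq_empty_or_nonempty with he | hne
  · simp [he]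
  · have : Finset.Ioi p = Finset.Ici ((Finset.Ioi p).min' hne) := by
      ext q
      rw [Finset.mem_Ici]
      exact ⟨fun hq => Finset.min'_le _ _ hq, fun hq => Finset.mem_Ioi.2
        ((Finset.mem_Ioi.1 (Finset.min'_mem _ hne)).trans_le hq)⟩
    rw [this]
    exact h _

/-- The sum beyond `q` equals the sum from the nearest nonzero position `p` on. Since the sums from
`p` and beyond `p` both lie in `{0, 1}`, the former is `1` exactly when `f p = 1`. -/
theorem exists_nearest_eq_one_iff {f : α → ℤ}
    (h : ∀ p, ∑ q ∈ Finset.Ici p, f q = 0 ∨ ∑ q ∈ Finset.Ici p, f q = 1) (q : α) :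
    (∃ p, q < p ∧ f p = 1 ∧ ∀ r, q < r → r < p → f r = 0) ↔ ∑ r ∈ Finset.Ioi q, f r = 1 := by
  have hsum (p : α) : ∑ r ∈ Finset.Ici p, f r = f p + ∑ r ∈ Finset.Ioi p, f r := by
    rw [← Finset.Ioi_insert, Finset.sum_insert (by simp)]
  have hcut {p : α} (hp : q < p) (hz : ∀ r, q < r → r < p → f r = 0) :
      ∑ r ∈ Finset.Ioi q, f r = ∑ r ∈ Finset.Ici p, f r := by
    refine (Finset.sum_subset (fun r hr => Finset.mem_Ioi.2
      (hp.trans_le (Finset.mem_Ici.1 hr))) fun r hr hr' => ?_).symm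
    exact hz r (Finset.mem_Ioi.1 hr) (not_le.1 fun h => hr' (Finset.mem_Ici.2 h))
  constructor
  · rintro ⟨p, hp, hfp, hz⟩
    rw [hcut hp hz]
    have h1 := hsum p
    have h2 := sum_Ioi_eq_zero_or_one h p
    have h3 := h p
    omega
  · intro hs
    have hne : ((Finset.Ioi q).filter fun r => f r ≠ 0).Nonempty := by
      obtain ⟨r, hr, hr'⟩ := Finset.exists_ne_zero_of_sum_ne_zero (hs.trans_ne one_ne_zero)
      exact ⟨r, Finset.mem_filter.2 ⟨hr, hr'⟩⟩
    set p := Finset.min' _ hne with hpdef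
    have hp := Finset.mem_filter.1 (Finset.min'_mem _ hne)
    rw [← hpdef, Finset.mem_Ioi] at hp
    have hz : ∀ r, q < r → r < p → f r = 0 := by
      intro r hr hrp
      by_contra hfr
      exact absurd (Finset.min'_le _ r (Finset.mem_filter.2 ⟨Finset.mem_Ioi.2 hr, hfr⟩))
        (not_le.2 hrp)
    refine ⟨p, hp.1, ?_, hz⟩
    have h1 := hsum p
    have h2 := sum_Ioi_eq_zero_or_one h p
    rw [← hcut hp.1 hz, hs] at h1
    have h3 := hp.2
    omega

end Nearest

theorem IsMuASM.nearestRightIsOne_iff {n m : ℕ} {mu : Fin n → ℕ}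
    {A : Matrix (Fin n) (Fin m) ℤ} (hA : IsMuASM mu A) (i : Fin n) (q : Fin m) :
    NearestRightIsOne A i q ↔ ∑ p ∈ Finset.Ioi q, A i p = 1 :=
  exists_nearest_eq_one_iff (hA.row_partial i) q

theorem IsMuASM.nearestAboveIsOne_iff {n m : ℕ} {mu : Fin n → ℕ}
    {A : Matrix (Fin n) (Fin m) ℤ} (hA : IsMuASM mu A) (i : Fin n) (q : Fin m) :
    NearestAboveIsOne A i q ↔ ∑ j ∈ Finset.Iio i, A j q = 1 := by
  -- Looking up a column is looking right in the dual order.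
  have key := exists_nearest_eq_one_iff (α := (Fin n)ᵒᵈ)
    (f := fun j => A (OrderDual.ofDual j) q) (fun p => hA.col_partial (OrderDual.ofDual p) q)
    (OrderDual.toDual i)
  refine Iff.trans ?_ key
  constructor
  · rintro ⟨j, h1, h2, h3⟩
    exact ⟨OrderDual.toDual j, h1, h2, fun r hr hr' => h3 _ hr' hr⟩
  · rintro ⟨j, h1, h2, h3⟩
    exact ⟨OrderDual.ofDual j, h1, h2, fun r hr hr' => h3 _ hr' hr⟩

/-! ### Deleting the last row of an alternating sign matrix. -/

theorem IsMuASM.sum_col {n m : ℕ} {b : Fin n → ℕ} {A : Matrix (Fin n) (Fin m) ℤ}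
    (hA : IsMuASM (fun j => b j + 1) A) (q : Fin m) : ∑ i, A i q = rangeIndicator b q := by
  rw [rangeIndicator]
  split_ifs with h
  · exact hA.col_sum_part q (h.imp fun j hj => by rw [hj])
  · exact hA.col_sum_not_part q fun ⟨j, hj⟩ => h ⟨j, Nat.succ_injective hj⟩

theorem IsMuASM.of_sum_col {n m : ℕ} {b : Fin n → ℕ} {A : Matrix (Fin n) (Fin m) ℤ}
    (entry_mem : ∀ i q, A i q = -1 ∨ A i q = 0 ∨ A i q = 1)
    (row_partial : ∀ i p, ∑ q ∈ Finset.Ici p, A i q = 0 ∨ ∑ q ∈ Finset.Ici p, A i q = 1)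
    (col_partial : ∀ j q, ∑ i ∈ Finset.Iic j, A i q = 0 ∨ ∑ i ∈ Finset.Iic j, A i q = 1)
    (row_sum : ∀ i, ∑ q, A i q = 1) (sum_col : ∀ q, ∑ i, A i q = rangeIndicator b q) :
    IsMuASM (fun j => b j + 1) A where
  entry_mem := entry_mem
  row_partial := row_partial
  col_partial := col_partial
  row_sum := row_sum
  col_sum_part q h := by
    rw [sum_col]
    exact if_pos (h.imp fun j hj => Nat.succ_injective hj)
  col_sum_not_part q h := by
    rw [sum_col]
    exact if_neg fun ⟨j, hj⟩ => h ⟨j, by rw [hj]⟩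

/-- The matrix without its last row. -/
def Matrix.deleteLastRow {n m : ℕ} (A : Matrix (Fin (n + 1)) (Fin m) ℤ) :
    Matrix (Fin n) (Fin m) ℤ := fun i => A i.castSucc

theorem Matrix.sum_Iic_castSucc {n m : ℕ} (A : Matrix (Fin (n + 1)) (Fin m) ℤ) (j : Fin n)
    (q : Fin m) : ∑ i ∈ Finset.Iic j.castSucc, A i q = ∑ i ∈ Finset.Iic j, A.deleteLastRow i q := by
  rw [← Fin.map_castSuccEmb_Iic, Finset.sum_map]
  rfl

theorem Matrix.sum_univ_row {n m : ℕ} (A : Matrix (Fin (n + 1)) (Fin m) ℤ) (q : Fin m) :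
    ∑ i, A i q = ∑ i, A.deleteLastRow i q + A (Fin.last n) q :=
  Fin.sum_univ_castSucc _

theorem rangeIndicator_eq_zero_or_one {n : ℕ} (b : Fin n → ℕ) (q : ℕ) :
    rangeIndicator b q = 0 ∨ rangeIndicator b q = 1 := by
  rw [rangeIndicator]
  split_ifs <;> simp

theorem IsMuASM.of_deleteLastRow {n m : ℕ} {b : Fin (n + 1) → ℕ} {c : Fin n → ℕ}
    (hb : StrictAnti b) (hc : StrictAnti c) (hbm : ∀ j, b j < m) (hbc : Interlaces b c)
    {A : Matrix (Fin (n + 1)) (Fin m) ℤ} (hA : IsMuASM (fun j => c j + 1) A.deleteLastRow)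
    (hlast : ∀ q, A (Fin.last n) q = rangeIndicator b q - rangeIndicator c q) :
    IsMuASM (fun j => b j + 1) A := by
  have hcm (j) : c j < m := (hbc j).2.trans_lt (hbm _)
  have hcol (q) : ∑ i, A i q = rangeIndicator b q := by
    rw [A.sum_univ_row, hA.sum_col, hlast]
    ring
  refine .of_sum_col (fun i q => ?_) (fun i p => ?_) (fun i q => ?_) (fun i => ?_) hcol
  · cases i using Fin.lastCases with
    | last =>
      have h1 := rangeIndicator_eq_zero_or_one b q
      have h2 := rangeIndicator_eq_zero_or_one c q
      have := hlast q
      omega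
    | cast i => exact hA.entry_mem i q
  · cases i using Fin.lastCases with
    | last =>
      simp_rw [hlast]
      rw [Finset.sum_sub_distrib, sum_Ici_rangeIndicator hb.injective hbm,
        sum_Ici_rangeIndicator hc.injective hcm]
      have := hbc.countGE_le_countGE hb.antitone hc.antitone p
      omega
    | cast i => exact hA.row_partial i p
  · cases i using Fin.lastCases with
    | last =>
      have : Finset.Iic (Fin.last n) = Finset.univ := Finset.Iic_top
      rw [this, hcol]
      exact rangeIndicator_eq_zero_or_one b q
    | cast i =>
      rw [A.sum_Iic_castSucc]
      exact hA.col_partial i q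
  · cases i using Fin.lastCases with
    | last =>
      simp_rw [hlast]
      rw [Finset.sum_sub_distrib, sum_rangeIndicator hb.injective hbm,
        sum_rangeIndicator hc.injective hcm]
      push_cast
      ring
    | cast i => exact hA.row_sum i

theorem Finset.exists_strictAnti_range {n : ℕ} (s : Finset ℕ) (hs : s.card = n) :
    ∃ c : Fin n → ℕ, StrictAnti c ∧ ∀ q, q ∈ s ↔ ∃ j, c j = q := by
  refine ⟨fun j => s.orderEmbOfFin hs j.rev, fun i j hij =>
    (s.orderEmbOfFin hs).strictMono (Fin.rev_lt_rev.2 hij), fun q => ?_⟩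
  have : q ∈ s ↔ q ∈ Set.range (s.orderEmbOfFin hs) := by
    rw [Finset.range_orderEmbOfFin, Finset.mem_coe]
  rw [this]
  exact ⟨fun ⟨j, hj⟩ => ⟨j.rev, by simpa using hj⟩, fun ⟨j, hj⟩ => ⟨j.rev, hj⟩⟩

/-- The column sums of the upper rows are `0` or `1` and total `n`, so they are the indicator of an
`n`-set, listed decreasingly by `c`. The suffix sums of the last row are then `countGE b - countGE
c`, and their lying in `{0, 1}` is interlacing. -/
theorem IsMuASM.exists_deleteLastRow {n m : ℕ} {b : Fin (n + 1) → ℕ} (hb : StrictAnti b)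
    (hbm : ∀ j, b j < m) {A : Matrix (Fin (n + 1)) (Fin m) ℤ}
    (hA : IsMuASM (fun j => b j + 1) A) :
    ∃ c : Fin n → ℕ, StrictAnti c ∧ Interlaces b c ∧
      IsMuASM (fun j => c j + 1) A.deleteLastRow ∧
      ∀ q, A (Fin.last n) q = rangeIndicator b q - rangeIndicator c q := by
  have htop (q : Fin m) : ∑ i, A.deleteLastRow i q = 0 ∨ ∑ i, A.deleteLastRow i q = 1 := by
    cases n with
    | zero => simp
    | succ n =>
      have : Finset.Iic (Fin.last n) = Finset.univ := Finset.Iic_top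
      rw [← this, ← A.sum_Iic_castSucc]
      exact hA.col_partial _ q
  let s : Finset (Fin m) := Finset.univ.filter fun q => ∑ i, A.deleteLastRow i q = 1
  have hs : s.card = n := by
    have h1 : ((s.card : ℕ) : ℤ) = ∑ q, ∑ i, A.deleteLastRow i q := by
      rw [Finset.card_filter, Nat.cast_sum]
      refine Finset.sum_congr rfl fun q _ => ?_
      rcases htop q with h | h <;> simp [h]
    rw [Finset.sum_comm] at h1
    have h2 (i : Fin n) : ∑ q, A.deleteLastRow i q = 1 := hA.row_sum i.castSucc
    simp only [h2, Finset.sum_const, Finset.card_univ, Fintype.card_fin, nsmul_eq_mul,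
      mul_one] at h1
    exact_mod_cast h1
  obtain ⟨c, hc, hcs⟩ := (s.map Fin.valEmbedding).exists_strictAnti_range
    ((Finset.card_map _).trans hs)
  have hcm (j) : c j < m := by
    obtain ⟨q, -, hq⟩ := Finset.mem_map.1 ((hcs (c j)).2 ⟨j, rfl⟩)
    rw [← hq]
    exact q.2
  have hcol (q : Fin m) : ∑ i, A.deleteLastRow i q = rangeIndicator c q := by
    have : (∃ j, c j = q) ↔ ∑ i, A.deleteLastRow i q = 1 := by
      rw [← hcs]
      simp [s, Fin.val_inj]
    rw [rangeIndicator]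
    split_ifs with h
    · exact this.1 h
    · exact (htop q).resolve_right (mt this.2 h)
  have hlast (q : Fin m) : A (Fin.last n) q = rangeIndicator b q - rangeIndicator c q := by
    have := hA.sum_col q
    rw [A.sum_univ_row, hcol] at this
    linarith
  refine ⟨c, hc, ?_, .of_sum_col (fun i => hA.entry_mem i.castSucc)
    (fun i => hA.row_partial i.castSucc) (fun i q => ?_) (fun i => hA.row_sum i.castSucc) hcol,
    hlast⟩
  · refine interlaces_of_countGE hb.antitone hc.antitone hbm hcm fun p hp => ?_
    have := hA.row_partial (Fin.last n) ⟨p, hp⟩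
    simp_rw [hlast] at this
    rw [Finset.sum_sub_distrib, sum_Ici_rangeIndicator hb.injective hbm,
      sum_Ici_rangeIndicator hc.injective hcm] at this
    dsimp only at this
    omega
  · rw [← A.sum_Iic_castSucc]
    exact hA.col_partial _ q

/-- A vertex type depends only on its own row and the rows above it. -/
theorem compassMatrix_castSucc {n m : ℕ} (A : Matrix (Fin (n + 1)) (Fin m) ℤ) (i : Fin n)
    (q : Fin m) : compassMatrix A i.castSucc q = compassMatrix A.deleteLastRow i q := by
  have h : NearestAboveIsOne A i.castSucc q ↔ NearestAboveIsOne A.deleteLastRow i q := by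
    constructor
    · rintro ⟨j, h1, h2, h3⟩
      obtain ⟨j, rfl⟩ := Fin.exists_castSucc_eq.2 (h1.trans (Fin.castSucc_lt_last i)).ne
      exact ⟨j, Fin.castSucc_lt_castSucc_iff.1 h1, h2, fun k hk hk' =>
        h3 k.castSucc (Fin.castSucc_lt_castSucc_iff.2 hk) (Fin.castSucc_lt_castSucc_iff.2 hk')⟩
    · rintro ⟨j, h1, h2, h3⟩
      refine ⟨j.castSucc, Fin.castSucc_lt_castSucc_iff.2 h1, h2, fun k hk hk' => ?_⟩
      obtain ⟨k, rfl⟩ := Fin.exists_castSucc_eq.2 (hk'.trans (Fin.castSucc_lt_last i)).ne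
      exact h3 k (Fin.castSucc_lt_castSucc_iff.1 hk) (Fin.castSucc_lt_castSucc_iff.1 hk')
  unfold compassMatrix
  simp only [h]
  rfl

/-- The weight of a vertex type in a row with spectral parameters `x` and `y`. -/
def Compass.weight {R : Type*} [CommRing R] (x y : R) : Compass → R
  | .NE => x
  | .SE => y
  | .NS => x + y
  | _ => 1

theorem prod_compass_weight {R : Type*} [CommRing R] {n m : ℕ} (x y : R)
    (A : Matrix (Fin n) (Fin m) ℤ) (k : Fin n) :
    x ^ compassCount Compass.NE A k * y ^ compassCount Compass.SE A k *
      (x + y) ^ compassCount Compass.NS A k = ∏ q, (compassMatrix A k q).weight x y := by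
  have h (z : R) (c : Compass) : z ^ compassCount c A k =
      ∏ q, if compassMatrix A k q = c then z else 1 := by
    rw [Finset.prod_ite, Finset.prod_const, Finset.prod_const_one, mul_one]
    rfl
  rw [h, h, h, ← Finset.prod_mul_distrib, ← Finset.prod_mul_distrib]
  refine Finset.prod_congr rfl fun q _ => ?_
  cases compassMatrix A k q <;> simp [Compass.weight]

/-! ### The weight of the last row. -/

/-- The weight of the last row of an alternating sign matrix at an interlacing entry `c` between
`b` and `b'`. -/
def gapWeight {R : Type*} [CommRing R] (x y : R) (b b' c : ℕ) : R :=
  if c = b then 1 else x ^ (b - c - 1) * if c = b' then y else x + y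

theorem sum_Ioi_rangeIndicator {n m : ℕ} {b : Fin n → ℕ} (hb : Function.Injective b)
    (hbm : ∀ j, b j < m) (p : Fin m) :
    ∑ q ∈ Finset.Ioi p, rangeIndicator b q = countGE b (p + 1) := by
  simp_rw [rangeIndicator_eq_sum hb]
  rw [Finset.sum_comm, countGE, Finset.card_filter, Nat.cast_sum]
  refine Finset.sum_congr rfl fun j _ => ?_
  have (q : Fin m) : b j = (q : ℕ) ↔ (⟨b j, hbm j⟩ : Fin m) = q := by
    rw [Fin.ext_iff]
  simp only [this, Finset.sum_ite_eq, Finset.mem_Ioi, Fin.lt_def, Nat.succ_le_iff]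
  split_ifs <;> rfl

theorem countGE_sub_countGE_eq_one_iff {n : ℕ} {b : Fin (n + 1) → ℕ} {c : Fin n → ℕ}
    (hb : Antitone b) (hc : Antitone c) (hbc : Interlaces b c) (q : ℕ) :
    ((countGE b (q + 1) : ℤ) - countGE c (q + 1) = 1) ↔
      q < b (Fin.last n) ∨ ∃ j, c j ≤ q ∧ q < b j.castSucc := by
  have hcn := countGE_le c (q + 1)
  constructor
  · intro h
    rcases hcn.eq_or_lt with hn | hn
    · refine .inl ((lt_countGE_iff hb (q + 1) _).1 ?_)
      rw [Fin.val_last]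
      omega
    -- The first index with `c j ≤ q`.
    · let j : Fin n := ⟨countGE c (q + 1), hn⟩
      refine .inr ⟨j, ?_, (lt_countGE_iff hb (q + 1) _).1 ?_⟩
      · have := mt (lt_countGE_iff hc (q + 1) j).2 (lt_irrefl _)
        omega
      · change countGE c (q + 1) < _
        omega
  · have h1 := hbc.countGE_le_countGE hb hc (q + 1)
    rintro (h | ⟨j, h2, h3⟩)
    · have := (lt_countGE_iff hb (q + 1) (Fin.last n)).2 h
      rw [Fin.val_last] at this
      omega
    · have h4 := (lt_countGE_iff hb (q + 1) j.castSucc).2 h3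
      have h5 := mt (lt_countGE_iff hc (q + 1) j).1 (by omega)
      rw [Fin.val_castSucc] at h4
      omega

section LastRow

variable {R : Type*} [CommRing R] {n m : ℕ} {b : Fin (n + 1) → ℕ} {c : Fin n → ℕ}

/-- Horizontal edges point east left of the last `b` and on the disjoint gaps `[c j, b j)`, so at
most one factor is nontrivial. In a gap the left end is `SE` if `c j` is also a value of `b`
(necessarily `b j.succ`) and `NS` otherwise; all further positions are `NE`. Outside these regions
only types of weight `1` occur. -/
theorem weight_compassMatrix_last (hb : StrictAnti b) (hc : StrictAnti c) (hbm : ∀ j, b j < m)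
    (hbc : Interlaces b c) {A : Matrix (Fin (n + 1)) (Fin m) ℤ}
    (hA : IsMuASM (fun j => b j + 1) A) (hA' : IsMuASM (fun j => c j + 1) A.deleteLastRow)
    (hlast : ∀ q, A (Fin.last n) q = rangeIndicator b q - rangeIndicator c q)
    (x y : R) (q : Fin m) :
    (compassMatrix A (Fin.last n) q).weight x y =
      (∏ j : Fin n, if c j ≤ q ∧ q < b j.castSucc then
        (if (q : ℕ) = c j then (if c j = b j.succ then y else x + y) else x) else 1) *
        if (q : ℕ) < b (Fin.last n) then x else 1 := by
  have hcm (j) : c j < m := (hbc j).2.trans_lt (hbm _)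
  have hright : NearestRightIsOne A (Fin.last n) q ↔
      (q : ℕ) < b (Fin.last n) ∨ ∃ j, c j ≤ q ∧ (q : ℕ) < b j.castSucc := by
    rw [hA.nearestRightIsOne_iff, ← countGE_sub_countGE_eq_one_iff hb.antitone hc.antitone hbc]
    simp_rw [hlast]
    rw [Finset.sum_sub_distrib, sum_Ioi_rangeIndicator hb.injective hbm,
      sum_Ioi_rangeIndicator hc.injective hcm]
  have habove : NearestAboveIsOne A (Fin.last n) q ↔ rangeIndicator c q = 1 := by
    rw [hA.nearestAboveIsOne_iff, ← hA'.sum_col, Fin.Iio_last_eq_map, Finset.sum_map]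
    rfl
  by_cases h1 : (q : ℕ) < b (Fin.last n)
  · have hbl (j) : (q : ℕ) < b j := h1.trans_le (hb.antitone (Fin.le_last j))
    have hcl (j) : (q : ℕ) < c j := (hbl _).trans_le (hbc j).1
    have hb0 := rangeIndicator_of_forall_ne fun j => (hbl j).ne'
    have hc0 := rangeIndicator_of_forall_ne fun j => (hcl j).ne'
    rw [if_pos h1, Finset.prod_eq_one fun j _ => if_neg fun h => absurd h.1 (not_le.2 (hcl j))]
    simp [compassMatrix, hlast, hb0, hc0, hright, h1, habove, Compass.weight]
  rw [if_neg h1, mul_one]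
  by_cases h2 : ∃ j, c j ≤ q ∧ (q : ℕ) < b j.castSucc
  · have hR := hright.2 (.inr h2)
    obtain ⟨j, hj, hj'⟩ := h2
    have hlt {i} (hi : i < j) : (q : ℕ) < c i := hj'.trans_le
      ((hb.antitone (Fin.succ_le_castSucc_iff.2 hi)).trans (hbc i).1)
    have hgt {i} (hi : j < i) : b i.castSucc ≤ q :=
      ((hb.antitone (Fin.succ_le_castSucc_iff.2 hi)).trans (hbc j).1).trans hj
    rw [Finset.prod_eq_single j (fun i _ hij => if_neg fun h => ?_) (by simp), if_pos ⟨hj, hj'⟩]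
    · rcases hj.eq_or_lt with he | hlt'
      · have hc1 : rangeIndicator c q = 1 := he ▸ rangeIndicator_apply c j
        rw [if_pos he.symm]
        split_ifs with hs
        · have hb1 : rangeIndicator b q = 1 := by
            rw [← he, hs]
            exact rangeIndicator_apply b _
          simp [compassMatrix, hlast, hb1, hc1, hR, habove, Compass.weight]
        · have hb0 : rangeIndicator b q = 0 := by
            refine rangeIndicator_of_forall_ne fun i hi => ?_
            rcases le_or_gt i j.castSucc with h | h
            · exact absurd (hb.antitone h) (by omega)
            · rcases (Fin.castSucc_lt_iff_succ_le.1 h).eq_or_lt with h' | h'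
              · exact hs (by rw [h', hi, he])
              · have := hb h'
                have := (hbc j).1
                omega
          simp [compassMatrix, hlast, hb0, hc1, Compass.weight]
      · rw [if_neg hlt'.ne']
        have hc0 : rangeIndicator c q = 0 := by
          refine rangeIndicator_of_forall_ne fun i hi => ?_
          rcases lt_trichotomy i j with h | h | h
          · exact absurd (hlt h) (by omega)
          · exact absurd hi (by rw [h]; omega)
          · exact absurd (hc h) (by omega)
        have hb0 : rangeIndicator b q = 0 := by
          refine rangeIndicator_of_forall_ne fun i hi => ?_
          rcases le_or_gt i j.castSucc with h | h
          · exact absurd (hb.antitone h) (by omega)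
          · have := hb.antitone (Fin.castSucc_lt_iff_succ_le.1 h)
            have := (hbc j).1
            omega
        simp [compassMatrix, hlast, hb0, hc0, hR, habove, Compass.weight]
    · rcases lt_or_gt_of_ne hij with h' | h'
      · exact absurd (hlt h') (by omega)
      · exact absurd (hgt h') (by omega)
  · have hR : ¬ NearestRightIsOne A (Fin.last n) q := by
      rw [hright]
      exact not_or.2 ⟨h1, h2⟩
    rw [Finset.prod_eq_one fun j _ => if_neg fun h => h2 ⟨j, h⟩]
    -- An entry `-1` sits at a value of `c` that is not a value of `b`, hence opens a nonempty gap.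
    have hneg : A (Fin.last n) q ≠ -1 := by
      intro h
      rw [hlast] at h
      have hb1 := rangeIndicator_eq_zero_or_one b q
      have hc1 := rangeIndicator_eq_zero_or_one c q
      have hc1 : ∃ j, c j = q := by
        by_contra hcon
        have := rangeIndicator_of_forall_ne fun j hj => hcon ⟨j, hj⟩
        omega
      obtain ⟨j, hj⟩ := hc1
      refine h2 ⟨j, hj.le, ?_⟩
      refine lt_of_le_of_ne (hj ▸ (hbc j).2) fun hq => ?_
      have : rangeIndicator b q = 1 := hq ▸ rangeIndicator_apply b _
      omega
    unfold compassMatrix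
    rw [if_neg hR, if_neg hneg]
    split_ifs <;> rfl

theorem Fin.prod_ite_lt {M : Type*} [CommMonoid M] {m k l : ℕ} (hl : l ≤ m) (f : ℕ → M) :
    (∏ q : Fin m, if k ≤ q ∧ (q : ℕ) < l then f q else 1) = ∏ q ∈ Finset.Ico k l, f q := by
  rw [Fin.prod_univ_eq_prod_range (fun q => if k ≤ q ∧ q < l then f q else 1),
    ← Finset.prod_filter]
  refine Finset.prod_congr ?_ fun _ _ => rfl
  ext q
  simp only [Finset.mem_filter, Finset.mem_range, Finset.mem_Ico]
  omega

theorem prod_Ico_gap (x y : R) {k k' l : ℕ} (h : k ≤ l) :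
    (∏ q ∈ Finset.Ico k l, if q = k then (if k = k' then y else x + y) else x) =
      gapWeight x y l k' k := by
  rcases h.eq_or_lt with rfl | h
  · simp [gapWeight]
  · rw [Finset.prod_eq_prod_Ico_succ_bot h, if_pos rfl, gapWeight, if_neg h.ne, mul_comm]
    congr 1
    rw [Finset.prod_congr rfl (g := fun _ => x), Finset.prod_const, Nat.card_Ico, Nat.sub_sub]
    intro q hq
    rw [Finset.mem_Ico] at hq
    exact if_neg (by omega)

theorem prod_weight_compassMatrix_last (hb : StrictAnti b) (hc : StrictAnti c)
    (hbm : ∀ j, b j < m) (hbc : Interlaces b c) {A : Matrix (Fin (n + 1)) (Fin m) ℤ}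
    (hA : IsMuASM (fun j => b j + 1) A) (hA' : IsMuASM (fun j => c j + 1) A.deleteLastRow)
    (hlast : ∀ q, A (Fin.last n) q = rangeIndicator b q - rangeIndicator c q) (x y : R) :
    ∏ q, (compassMatrix A (Fin.last n) q).weight x y =
      x ^ b (Fin.last n) * ∏ j : Fin n, gapWeight x y (b j.castSucc) (b j.succ) (c j) := by
  simp_rw [weight_compassMatrix_last hb hc hbm hbc hA hA' hlast]
  rw [Finset.prod_mul_distrib, mul_comm, Finset.prod_comm]
  congr 1
  · have := Fin.prod_ite_lt (k := 0) (hbm (Fin.last n)).le fun _ => x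
    simpa using this
  · refine Finset.prod_congr rfl fun j _ => ?_
    rw [Fin.prod_ite_lt (hbm j.castSucc).le fun q => if q = c j then
      (if c j = b j.succ then y else x + y) else x, prod_Ico_gap x y (hbc j).2]

/-! ### Row recursion for the weighted enumeration. -/

/-- The weighted enumeration of alternating sign matrices whose nonzero column sums are in the
columns with (zero-based) indices `b`. -/
noncomputable def asmSum {n : ℕ} (m : ℕ) (b : Fin n → ℕ) (x y : Fin n → R) : R :=
  ∑ A ∈ muASM m (fun j => b j + 1), ∏ k, ∏ q, (compassMatrix A k q).weight (x k) (y k)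

theorem mem_muASM {n m : ℕ} {mu : Fin n → ℕ} {A : Matrix (Fin n) (Fin m) ℤ} :
    A ∈ muASM m mu ↔ IsMuASM mu A := by
  simp [muASM]

theorem rangeIndicator_injective {n m : ℕ} {c c' : Fin n → ℕ} (hc : StrictAnti c)
    (hc' : StrictAnti c') (hcm : ∀ j, c j < m) (hcm' : ∀ j, c' j < m)
    (h : ∀ q : Fin m, rangeIndicator c q = rangeIndicator c' q) : c = c' := by
  have hge (p : Fin m) : countGE c p = countGE c' p := by
    have := sum_Ici_rangeIndicator hc.injective hcm p
    simp_rw [h] at this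
    rw [sum_Ici_rangeIndicator hc'.injective hcm' p] at this
    exact_mod_cast this.symm
  funext j
  refine le_antisymm ?_ ?_
  · exact (lt_countGE_iff hc'.antitone _ j).1
      (hge ⟨c j, hcm j⟩ ▸ (lt_countGE_iff hc.antitone _ j).2 le_rfl)
  · exact (lt_countGE_iff hc.antitone _ j).1
      (hge ⟨c' j, hcm' j⟩ ▸ (lt_countGE_iff hc'.antitone _ j).2 le_rfl)

-- Matrices correspond to pairs of an interlacing strict `c` and a smaller matrix, the last row
-- being recovered as a difference of indicators.
open Classical in
theorem asmSum_succ (hb : StrictAnti b) (hbm : ∀ j, b j < m) (x y : Fin (n + 1) → R) :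
    asmSum m b x y = ∑ c ∈ (Fintype.piFinset fun j : Fin n =>
        Finset.Icc (b j.succ) (b j.castSucc)).filter StrictAnti,
      (x (Fin.last n) ^ b (Fin.last n) * ∏ j : Fin n,
        gapWeight (x (Fin.last n)) (y (Fin.last n)) (b j.castSucc) (b j.succ) (c j)) *
        asmSum m c (fun k => x k.castSucc) (fun k => y k.castSucc) := by
  simp_rw [asmSum, Finset.mul_sum]
  rw [Finset.sum_sigma']
  have hmem (c : Fin n → ℕ) : c ∈ (Fintype.piFinset fun j : Fin n =>
      Finset.Icc (b j.succ) (b j.castSucc)).filter StrictAnti ↔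
      Interlaces b c ∧ StrictAnti c := by
    simp [Interlaces]
  let ext (p : Σ _ : Fin n → ℕ, Matrix (Fin n) (Fin m) ℤ) : Matrix (Fin (n + 1)) (Fin m) ℤ :=
    fun i => Fin.lastCases (motive := fun _ => Fin m → ℤ)
      (fun q => rangeIndicator b q - rangeIndicator p.1 q) p.2 i
  have hext1 (p) (q) : ext p (Fin.last n) q = rangeIndicator b q - rangeIndicator p.1 q :=
    congrFun (Fin.lastCases_last (motive := fun _ => Fin m → ℤ)
      (last := fun q : Fin m => rangeIndicator b q - rangeIndicator p.1 q)) q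
  have hext2 (p) : (ext p).deleteLastRow = p.2 := by
    ext i q
    exact congrFun (Fin.lastCases_castSucc (motive := fun _ => Fin m → ℤ)
      (last := fun q : Fin m => rangeIndicator b q - rangeIndicator p.1 q) (cast := p.2) i) q
  symm
  refine Finset.sum_bij (fun p _ => ext p) ?_ ?_ ?_ ?_
  · rintro p hp
    obtain ⟨h1, h2⟩ := Finset.mem_sigma.1 hp
    rw [hmem] at h1
    rw [mem_muASM] at h2 ⊢
    exact .of_deleteLastRow hb h1.2 hbm h1.1 (by rwa [hext2]) (hext1 p)
  · rintro ⟨c, A⟩ hp ⟨c', A'⟩ hp' he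
    obtain ⟨h1, -⟩ := Finset.mem_sigma.1 hp
    obtain ⟨h1', -⟩ := Finset.mem_sigma.1 hp'
    rw [hmem] at h1 h1'
    have hA : A = A' := by
      have := congrArg Matrix.deleteLastRow he
      rwa [hext2, hext2] at this
    have hc : c = c' := by
      refine rangeIndicator_injective h1.2 h1'.2 (fun j => (h1.1 j).2.trans_lt (hbm _))
        (fun j => (h1'.1 j).2.trans_lt (hbm _)) fun q => ?_
      have := congrFun (congrFun he (Fin.last n)) q
      simp only [hext1] at this
      linarith
    rw [hA, hc]
  · intro A hA
    obtain ⟨c, h1, h2, h3, h4⟩ := (mem_muASM.1 hA).exists_deleteLastRow hb hbm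
    refine ⟨⟨c, A.deleteLastRow⟩, Finset.mem_sigma.2 ⟨(hmem c).2 ⟨h2, h1⟩, mem_muASM.2 h3⟩, ?_⟩
    ext i q
    cases i using Fin.lastCases with
    | last => rw [hext1, h4]
    | cast i => exact congrFun (congrFun (hext2 ⟨c, A.deleteLastRow⟩) i) q
  · rintro p hp
    obtain ⟨h1, h2⟩ := Finset.mem_sigma.1 hp
    rw [hmem] at h1
    rw [mem_muASM] at h2
    have hd : IsMuASM (fun j => p.1 j + 1) (ext p).deleteLastRow := by rwa [hext2]
    rw [Fin.prod_univ_castSucc, prod_weight_compassMatrix_last hb h1.2 hbm h1.1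
      (.of_deleteLastRow hb h1.2 hbm h1.1 hd (hext1 p)) hd (hext1 p), mul_comm]
    simp_rw [compassMatrix_castSucc, hext2]

end LastRow

/-! ### The enumeration as an alternant. -/

section Alternant

variable {R : Type*} [CommRing R]

/-- Multiplying `∑ z ^ e * x ^ (d - e)` by `z + y` gives `y * x ^ d` at the bottom, `(x + y) * x ^
(d - e)` in the middle and `1` at the top: exactly the gap weights. -/
theorem sum_gapWeight_mul_pow (x y z : R) (k d : ℕ) :
    (∑ c ∈ Finset.Icc k (k + (d + 1)), gapWeight x y (k + (d + 1)) k c * z ^ c) * (z - x) =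
      (z + y) * (z ^ (k + (d + 1)) - x ^ (d + 1) * z ^ k) := by
  have h (d : ℕ) : ∑ c ∈ Finset.Icc k (k + (d + 1)), gapWeight x y (k + (d + 1)) k c * z ^ c =
      z ^ k * (∑ e ∈ Finset.range (d + 1), x ^ (d - e) * (if e = 0 then y else x + y) * z ^ e +
        z ^ (d + 1)) := by
    rw [← Finset.Ico_add_one_right_eq_Icc, Finset.sum_Ico_eq_sum_range, mul_add, Finset.mul_sum,
      show k + (d + 1) + 1 - k = d + 1 + 1 by omega, Finset.sum_range_succ]
    congr 1
    · refine Finset.sum_congr rfl fun e he => ?_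
      rw [Finset.mem_range] at he
      rw [gapWeight, if_neg (by omega), show k + (d + 1) - (k + e) - 1 = d - e by omega, pow_add]
      simp only [Nat.add_eq_left]
      ring
    · simp [gapWeight, pow_add]
  have h2 : (∑ e ∈ Finset.range (d + 1), x ^ (d - e) * (if e = 0 then y else x + y) * z ^ e +
      z ^ (d + 1)) * (z - x) = (z + y) * (z ^ (d + 1) - x ^ (d + 1)) := by
    induction d with
    | zero => simp; ring
    | succ d ih =>
      have : ∑ e ∈ Finset.range (d + 1), x ^ (d + 1 - e) * (if e = 0 then y else x + y) * z ^ e =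
          x * ∑ e ∈ Finset.range (d + 1), x ^ (d - e) * (if e = 0 then y else x + y) * z ^ e := by
        rw [Finset.mul_sum]
        refine Finset.sum_congr rfl fun e he => ?_
        rw [Finset.mem_range] at he
        rw [show d + 1 - e = d - e + 1 by omega, pow_succ]
        ring
      rw [Finset.sum_range_succ, this, if_neg (Nat.succ_ne_zero d), Nat.sub_self]
      linear_combination x * ih
  rw [h, mul_assoc, h2]
  ring

theorem Interlaces.antitone {n : ℕ} {b : Fin (n + 1) → ℕ} {c : Fin n → ℕ} (hb : Antitone b)
    (h : Interlaces b c) : Antitone c := by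
  intro i j hij
  rcases hij.eq_or_lt with rfl | hij
  · rfl
  · exact (h j).2.trans ((hb (Fin.succ_le_castSucc_iff.2 hij)).trans (h i).1)

/-- Two columns coincide. This allows a sum over strict `c` to be extended to all interlacing `c`.
-/
theorem Matrix.det_pow_eq_zero {n : ℕ} (x : Fin n → R) {c : Fin n → ℕ} (hc : Antitone c)
    (hc' : ¬ StrictAnti c) : (Matrix.of fun i j => x i ^ c j).det = 0 := by
  rw [StrictAnti] at hc'
  push Not at hc'
  obtain ⟨i, j, hij, h⟩ := hc'
  refine Matrix.det_zero_of_column_eq hij.ne fun k => ?_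
  simp [h.antisymm (hc hij.le)]

theorem asmSum_zero {m : ℕ} (b : Fin 0 → ℕ) (x y : Fin 0 → R) : asmSum m b x y = 1 := by
  have : muASM m (fun j => b j + 1) = {0} := by
    ext A
    rw [mem_muASM, Finset.mem_singleton]
    refine ⟨fun _ => Subsingleton.elim _ _, fun _ => .of_sum_col (fun i => i.elim0)
      (fun i => i.elim0) (fun i => i.elim0) (fun i => i.elim0) fun q => ?_⟩
    rw [rangeIndicator_of_forall_ne fun j => j.elim0]
    simp
  simp [asmSum, this]

open Classical in
theorem altVandermonde_mul_asmSum {n m : ℕ} {b : Fin n → ℕ} (hb : StrictAnti b)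
    (hbm : ∀ j, b j < m) (x y : Fin n → R) :
    altVandermonde x * asmSum m b x y =
      (∏ i : Fin n, ∏ j ∈ Finset.Ioi i, (x i + y j)) * (Matrix.of fun i j => x i ^ b j).det := by
  induction n with
  | zero => simp [asmSum_zero, altVandermonde]
  | succ n ih =>
    rw [Fin.prod_Ioi_castSucc fun i j => x i + y j, altVandermonde_succ, asmSum_succ hb hbm,
      mul_right_comm (∏ i : Fin n, (x i.castSucc - _)),
      mul_right_comm (∏ i : Fin n, (x i.castSucc + _)), ← prod_sub_mul_sum_det x b hb.antitone
        (fun j => Finset.Icc (b j.succ) (b j.castSucc))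
        (fun j => gapWeight (x (Fin.last n)) (y (Fin.last n)) (b j.castSucc) (b j.succ))
        (fun _ c => c) (fun z => z + y (Fin.last n))]
    · rw [mul_assoc, mul_assoc]
      congr 1
      rw [Finset.sum_mul, Finset.sum_mul, Finset.sum_filter]
      refine Finset.sum_congr rfl fun c hc => ?_
      have hbc : Interlaces b c := fun j => Finset.mem_Icc.1 (Fintype.mem_piFinset.1 hc j)
      split_ifs with h
      · rw [mul_assoc, mul_comm (asmSum _ _ _ _), ih h fun j => (hbc j).2.trans_lt (hbm _)]
        ring
      · rw [Matrix.det_pow_eq_zero _ (hbc.antitone hb.antitone) h]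
        ring
    · intro j z
      -- Strictness supplies the gap `d + 1`; for an empty gap the one-variable identity would fail.
      obtain ⟨d, hd⟩ := Nat.exists_eq_add_of_lt (hb (Fin.castSucc_lt_succ (i := j)))
      rw [add_assoc] at hd
      rw [hd, sum_gapWeight_mul_pow, Nat.add_sub_cancel_left]

end Alternant

/-! ### Tableaux: restriction, and extension by a horizontal strip. -/

theorem SemistandardYoungTableau.apply_mono {lam : YoungDiagram}
    (T : SemistandardYoungTableau lam) {i i' j j' : ℕ} (hi : i ≤ i') (hj : j ≤ j')
    (h : (i', j') ∈ lam) : T i j ≤ T i' j' :=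
  (T.row_weak_of_le hj (lam.up_left_mem hi le_rfl h)).trans (T.col_weak hi h)

theorem SemistandardYoungTableau.row_le_apply {lam : YoungDiagram}
    (T : SemistandardYoungTableau lam) {i j : ℕ} (h : (i, j) ∈ lam) : i ≤ T i j := by
  induction i with
  | zero => exact Nat.zero_le _
  | succ i ih =>
    exact (ih (lam.up_left_mem (Nat.le_succ i) le_rfl h)).trans_lt
      (T.col_strict (Nat.lt_succ_self i) h)

/-- The shape formed by the cells whose entries are less than `n`. -/
def SemistandardYoungTableau.shapeLT {lam : YoungDiagram} (T : SemistandardYoungTableau lam)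
    (n : ℕ) : YoungDiagram where
  cells := lam.cells.filter fun c => T c.1 c.2 < n
  isLowerSet := by
    rintro ⟨i', j'⟩ ⟨i, j⟩ hle h
    simp only [Finset.coe_filter, YoungDiagram.mem_cells, Set.mem_ofPred_eq] at h ⊢
    obtain ⟨hi, hj⟩ := Prod.mk_le_mk.1 hle
    exact ⟨lam.up_left_mem hi hj h.1, (T.apply_mono hi hj h.1).trans_lt h.2⟩

theorem SemistandardYoungTableau.mem_shapeLT {lam : YoungDiagram}
    (T : SemistandardYoungTableau lam) (n i j : ℕ) :
    (i, j) ∈ T.shapeLT n ↔ (i, j) ∈ lam ∧ T i j < n := by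
  rw [← YoungDiagram.mem_cells]
  simp [SemistandardYoungTableau.shapeLT]

/-- The restriction of a tableau to the cells whose entries are less than `n`. -/
def SemistandardYoungTableau.restrictLT {lam nu : YoungDiagram}
    (T : SemistandardYoungTableau lam) (h : nu ≤ lam) : SemistandardYoungTableau nu where
  entry i j := if (i, j) ∈ nu then T i j else 0
  row_weak' {i j1 j2} hj hc := by
    rw [if_pos hc, if_pos (nu.up_left_mem le_rfl hj.le hc)]
    exact T.row_weak hj (h hc)
  col_strict' {i1 i2 j} hi hc := by
    rw [if_pos hc, if_pos (nu.up_left_mem hi.le le_rfl hc)]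
    exact T.col_strict hi (h hc)
  zeros' {i j} hc := if_neg hc

theorem SemistandardYoungTableau.restrictLT_apply {lam nu : YoungDiagram}
    (T : SemistandardYoungTableau lam) (h : nu ≤ lam) {i j : ℕ} (hc : (i, j) ∈ nu) :
    T.restrictLT h i j = T i j :=
  if_pos hc

open Classical in
/-- The extension of a tableau `U` of shape `nu` with entries less than `n` to the larger shape
`lam` by entries equal to `n`, if `lam / nu` is a horizontal strip. -/
def SemistandardYoungTableau.extend {lam nu : YoungDiagram} (U : SemistandardYoungTableau nu)
    (n : ℕ) (hU : ∀ c ∈ nu.cells, U c.1 c.2 < n) (h : nu ≤ lam)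
    (hs : ∀ i, lam.rowLen (i + 1) ≤ nu.rowLen i) : SemistandardYoungTableau lam where
  entry i j := if (i, j) ∈ nu then U i j else if (i, j) ∈ lam then n else 0
  row_weak' {i j1 j2} hj hc := by
    by_cases h2 : (i, j2) ∈ nu
    · rw [if_pos h2, if_pos (nu.up_left_mem le_rfl hj.le h2)]
      exact U.row_weak hj h2
    · rw [if_neg h2, if_pos hc]
      split_ifs with h1
      · exact (hU _ ((nu.mem_cells _).2 h1)).le
      · exact le_rfl
      · exact Nat.zero_le _
  col_strict' {i1 i2 j} hi hc := by
    -- By the strip condition every cell above another cell of `lam` lies in `nu`, so no column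
    -- holds `n` twice.
    have h1 : (i1, j) ∈ nu := by
      rw [YoungDiagram.mem_iff_lt_rowLen] at hc ⊢
      exact hc.trans_le ((lam.rowLen_anti _ _ hi).trans (hs i1))
    rw [if_pos h1]
    by_cases h2 : (i2, j) ∈ nu
    · rw [if_pos h2]
      exact U.col_strict hi h2
    · rw [if_neg h2, if_pos hc]
      exact hU _ ((nu.mem_cells _).2 h1)
  zeros' {i j} hc := by
    rw [if_neg fun h' => hc (h h'), if_neg hc]

/-- The Young diagram with row lengths `a`, if `a` is antitone. -/
def YoungDiagram.ofFin {n : ℕ} (a : Fin n → ℕ) : YoungDiagram where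
  -- The bound `∑ i, a i` only ensures finiteness; testing all rows up to `c.1` gives a lower set
  -- for any `a`.
  cells := (Finset.range n ×ˢ Finset.range (∑ i, a i)).filter fun c =>
    ∀ i : Fin n, (i : ℕ) ≤ c.1 → c.2 < a i
  isLowerSet := by
    rintro ⟨i', j'⟩ ⟨i, j⟩ hle h
    simp only [Finset.coe_filter, Finset.mem_product, Finset.mem_range, Set.mem_ofPred_eq] at h ⊢
    obtain ⟨hi, hj⟩ := Prod.mk_le_mk.1 hle
    exact ⟨⟨by omega, by omega⟩, fun k hk => hj.trans_lt (h.2 k (hk.trans hi))⟩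

theorem YoungDiagram.mem_ofFin {n : ℕ} {a : Fin n → ℕ} (ha : Antitone a) {i j : ℕ} :
    (i, j) ∈ YoungDiagram.ofFin a ↔ ∃ h : i < n, j < a ⟨i, h⟩ := by
  rw [← YoungDiagram.mem_cells]
  simp only [YoungDiagram.ofFin, Finset.mem_filter, Finset.mem_product, Finset.mem_range]
  constructor
  · rintro ⟨⟨hi, -⟩, h⟩
    exact ⟨hi, h ⟨i, hi⟩ le_rfl⟩
  · rintro ⟨hi, h⟩
    exact ⟨⟨hi, h.trans_le (Finset.single_le_sum (fun _ _ => Nat.zero_le _)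
      (Finset.mem_univ _))⟩, fun k hk => h.trans_le (ha hk)⟩

theorem YoungDiagram.rowLen_ofFin {n : ℕ} {a : Fin n → ℕ} (ha : Antitone a) (i : Fin n) :
    (YoungDiagram.ofFin a).rowLen i = a i := by
  refine eq_of_forall_lt_iff fun j => ?_
  rw [← YoungDiagram.mem_iff_lt_rowLen, YoungDiagram.mem_ofFin ha]
  simp

theorem YoungDiagram.rowLen_eq_zero_iff {lam : YoungDiagram} {i : ℕ} :
    lam.rowLen i = 0 ↔ lam.colLen 0 ≤ i := by
  rw [← not_lt, ← YoungDiagram.mem_iff_lt_colLen, YoungDiagram.mem_iff_lt_rowLen]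
  omega

theorem YoungDiagram.colLen_ofFin_le {n : ℕ} (a : Fin n → ℕ) :
    (YoungDiagram.ofFin a).colLen 0 ≤ n := by
  by_contra! h
  rw [← YoungDiagram.mem_iff_lt_colLen, ← YoungDiagram.mem_cells] at h
  simp [YoungDiagram.ofFin] at h

theorem YoungDiagram.ext_rowLen {lam nu : YoungDiagram} {n : ℕ} (h1 : lam.colLen 0 ≤ n)
    (h2 : nu.colLen 0 ≤ n) (h : ∀ i : Fin n, lam.rowLen i = nu.rowLen i) : lam = nu := by
  refine YoungDiagram.ext (Finset.ext fun ⟨i, j⟩ => ?_)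
  rw [YoungDiagram.mem_cells, YoungDiagram.mem_cells, YoungDiagram.mem_iff_lt_rowLen,
    YoungDiagram.mem_iff_lt_rowLen]
  by_cases hi : i < n
  · rw [h ⟨i, hi⟩]
  · rw [YoungDiagram.rowLen_eq_zero_iff.2 (h1.trans (not_lt.1 hi)),
      YoungDiagram.rowLen_eq_zero_iff.2 (h2.trans (not_lt.1 hi))]

theorem YoungDiagram.card_cells_eq_sum_rowLen {lam : YoungDiagram} {n : ℕ}
    (h : lam.colLen 0 ≤ n) : lam.cells.card = ∑ i : Fin n, lam.rowLen i := by
  rw [Fin.sum_univ_eq_sum_range fun i => lam.rowLen i,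
    Finset.card_eq_sum_card_fiberwise (f := Prod.fst) (t := Finset.range n)]
  · exact Finset.sum_congr rfl fun i _ => lam.rowLen_eq_card.symm
  · rintro ⟨i, j⟩ hc
    have hc' : (i, 0) ∈ lam := lam.up_left_mem le_rfl (Nat.zero_le j) hc
    exact Finset.mem_coe.2 (Finset.mem_range.2
      ((YoungDiagram.mem_iff_lt_colLen.1 hc').trans_le h))

theorem YoungDiagram.ofFin_rowLen {nu : YoungDiagram} {n : ℕ} (h : nu.colLen 0 ≤ n) :
    YoungDiagram.ofFin (fun i : Fin n => nu.rowLen i) = nu :=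
  YoungDiagram.ext_rowLen (YoungDiagram.colLen_ofFin_le _) h fun i =>
    YoungDiagram.rowLen_ofFin (fun i j hij => nu.rowLen_anti i j hij) i

theorem SemistandardYoungTableau.shapeLT_le {lam : YoungDiagram}
    (T : SemistandardYoungTableau lam) (n : ℕ) : T.shapeLT n ≤ lam :=
  fun _ h => ((T.mem_shapeLT n _ _).1 h).1

theorem SemistandardYoungTableau.colLen_shapeLT_le {lam : YoungDiagram}
    (T : SemistandardYoungTableau lam) (n : ℕ) : (T.shapeLT n).colLen 0 ≤ n := by
  by_contra! h
  rw [← YoungDiagram.mem_iff_lt_colLen, T.mem_shapeLT] at h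
  exact absurd (T.row_le_apply h.1) (not_le.2 h.2)

theorem SemistandardYoungTableau.ofFin_rowLen_shapeLT {lam : YoungDiagram}
    (T : SemistandardYoungTableau lam) (n : ℕ) :
    YoungDiagram.ofFin (fun i : Fin n => (T.shapeLT n).rowLen i) = T.shapeLT n :=
  YoungDiagram.ofFin_rowLen (T.colLen_shapeLT_le n)

/-- Compares tableaux of propositionally equal shapes entrywise, avoiding casts. -/
theorem SemistandardYoungTableau.sigma_ext {α : Type*} {F : α → YoungDiagram}
    {p p' : Σ a, SemistandardYoungTableau (F a)} (h1 : p.1 = p'.1)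
    (h2 : ∀ i j, p.2 i j = p'.2 i j) : p = p' := by
  obtain ⟨a, T⟩ := p
  obtain ⟨a', T'⟩ := p'
  obtain rfl : a = a' := h1
  exact congrArg _ (SemistandardYoungTableau.ext h2)

theorem SemistandardYoungTableau.apply_eq_of_sigma_eq {α : Type*} {F : α → YoungDiagram}
    {p p' : Σ a, SemistandardYoungTableau (F a)} (h : p = p') (i j : ℕ) :
    p.2 i j = p'.2 i j := by
  rw [h]

theorem mem_boundedTableaux_toFinset {lam : YoungDiagram} {n : ℕ}
    {T : SemistandardYoungTableau lam} :
    T ∈ (boundedTableaux_finite lam n).toFinset ↔ ∀ i j, (i, j) ∈ lam → T i j < n := by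
  rw [Set.Finite.mem_toFinset]
  exact ⟨fun h i j hc => h (i, j) ((lam.mem_cells _).2 hc),
    fun h c hc => h c.1 c.2 ((lam.mem_cells _).1 hc)⟩

theorem tableauWeight_restrictLT {lam nu : YoungDiagram} (T : SemistandardYoungTableau lam)
    {n k : ℕ} (hk : k < n) (h : nu ≤ lam) (hnu : nu = T.shapeLT n) :
    tableauWeight (T.restrictLT h) k = tableauWeight T k := by
  unfold tableauWeight
  congr 1
  ext ⟨i, j⟩
  simp only [Finset.mem_filter, YoungDiagram.mem_cells]
  constructor
  · rintro ⟨h1, h2⟩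
    rw [T.restrictLT_apply h h1] at h2
    exact ⟨h h1, h2⟩
  · rintro ⟨h1, h2⟩
    have h3 : (i, j) ∈ nu := by
      rw [hnu, T.mem_shapeLT]
      exact ⟨h1, h2.trans_lt hk⟩
    rw [T.restrictLT_apply h h3]
    exact ⟨h3, h2⟩

theorem tableauWeight_last {lam : YoungDiagram} {n : ℕ} (hlam : lam.colLen 0 ≤ n + 1)
    {T : SemistandardYoungTableau lam} (hT : ∀ i j, (i, j) ∈ lam → T i j < n + 1)
    (hle : ∀ i : Fin n, (T.shapeLT n).rowLen i ≤ lam.rowLen i) :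
    tableauWeight T n =
      lam.rowLen n + ∑ i : Fin n, (lam.rowLen i - (T.shapeLT n).rowLen i) := by
  have h1 := YoungDiagram.card_cells_eq_sum_rowLen hlam
  have h2 := YoungDiagram.card_cells_eq_sum_rowLen (T.colLen_shapeLT_le n)
  have h3 : lam.cells.card = (T.shapeLT n).cells.card + tableauWeight T n := by
    rw [tableauWeight, ← Finset.card_filter_add_card_filter_not (s := lam.cells)
      (fun c => T c.1 c.2 < n)]
    congr 2
    refine Finset.filter_congr fun c hc => ?_
    have := hT c.1 c.2 ((lam.mem_cells _).1 hc)
    omega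
  have h4 : ∑ i : Fin n, (lam.rowLen i - (T.shapeLT n).rowLen i) +
      ∑ i : Fin n, (T.shapeLT n).rowLen i = ∑ i : Fin n, lam.rowLen i := by
    rw [← Finset.sum_add_distrib]
    exact Finset.sum_congr rfl fun i _ => Nat.sub_add_cancel (hle i)
  rw [Fin.sum_univ_castSucc] at h1
  simp only [Fin.val_castSucc, Fin.val_last] at h1
  omega

/-! ### Branching rule and bialternant formula. -/

section Schur

variable {R : Type*} [CommRing R]

/-- The branching rule for Schur functions. -/
theorem schurFunction_succ {lam : YoungDiagram} {n : ℕ} (hlam : lam.colLen 0 ≤ n + 1)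
    (x : Fin (n + 1) → R) :
    schurFunction lam x = ∑ a ∈ Fintype.piFinset fun j : Fin n =>
        Finset.Icc (lam.rowLen (j + 1)) (lam.rowLen j),
      (x (Fin.last n) ^ lam.rowLen n * ∏ j : Fin n, x (Fin.last n) ^ (lam.rowLen j - a j)) *
        schurFunction (YoungDiagram.ofFin a) fun k => x k.castSucc := by
  simp_rw [schurFunction, Finset.mul_sum]
  rw [Finset.sum_sigma']
  have hle (T : SemistandardYoungTableau lam) :
      YoungDiagram.ofFin (fun i : Fin n => (T.shapeLT n).rowLen i) ≤ lam :=
    (T.ofFin_rowLen_shapeLT n).le.trans (T.shapeLT_le n)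
  have hrow {lam nu : YoungDiagram} (h : nu ≤ lam) (i : ℕ) : nu.rowLen i ≤ lam.rowLen i := by
    refine le_of_forall_lt fun j hj => ?_
    rw [← YoungDiagram.mem_iff_lt_rowLen] at hj ⊢
    exact h hj
  refine Finset.sum_bij (fun T _ => ⟨fun i => (T.shapeLT n).rowLen i, T.restrictLT (hle T)⟩)
    ?_ ?_ ?_ ?_
  · intro T hT
    rw [mem_boundedTableaux_toFinset] at hT
    refine Finset.mem_sigma.2 ⟨Fintype.mem_piFinset.2 fun i => Finset.mem_Icc.2 ⟨?_, ?_⟩, ?_⟩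
    -- A cell with another one directly beneath it has an entry below `n`.
    · refine le_of_forall_lt fun j hj => ?_
      rw [← YoungDiagram.mem_iff_lt_rowLen] at hj ⊢
      rw [T.mem_shapeLT]
      exact ⟨lam.up_left_mem (Nat.le_succ _) le_rfl hj, (T.col_strict (Nat.lt_succ_self _)
        hj).trans_le (Nat.lt_succ_iff.1 (hT _ _ hj))⟩
    · exact hrow (T.shapeLT_le n) i
    · rw [mem_boundedTableaux_toFinset]
      intro i j hc
      rw [T.restrictLT_apply _ hc]
      dsimp only at hc
      rw [T.ofFin_rowLen_shapeLT, T.mem_shapeLT] at hc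
      exact hc.2
  · intro T hT T' hT' he
    rw [mem_boundedTableaux_toFinset] at hT hT'
    have h1 := congrArg Sigma.fst he
    have h2 : T.shapeLT n = T'.shapeLT n := by
      have := congrArg YoungDiagram.ofFin h1
      dsimp only at this
      rwa [T.ofFin_rowLen_shapeLT, T'.ofFin_rowLen_shapeLT] at this
    have h3 (i j : ℕ) : T.restrictLT (hle T) i j = T'.restrictLT (hle T') i j :=
      SemistandardYoungTableau.apply_eq_of_sigma_eq (F := YoungDiagram.ofFin) he i j
    refine SemistandardYoungTableau.ext fun i j => ?_
    by_cases hc : (i, j) ∈ lam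
    · by_cases hs : (i, j) ∈ T.shapeLT n
      · have := h3 i j
        rwa [T.restrictLT_apply _ (by rwa [T.ofFin_rowLen_shapeLT]),
          T'.restrictLT_apply _ (by rwa [T'.ofFin_rowLen_shapeLT, ← h2])] at this
      · have hs' := h2 ▸ hs
        rw [SemistandardYoungTableau.mem_shapeLT] at hs hs'
        have := hT i j hc
        have := hT' i j hc
        have h4 : ¬ T i j < n := fun h => hs ⟨hc, h⟩
        have h5 : ¬ T' i j < n := fun h => hs' ⟨hc, h⟩
        omega
    · rw [T.zeros hc, T'.zeros hc]
  · rintro ⟨a, U⟩ hp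
    obtain ⟨ha, hU⟩ := Finset.mem_sigma.1 hp
    rw [mem_boundedTableaux_toFinset] at hU
    dsimp only at U ha hU
    have ha (i) := Finset.mem_Icc.1 (Fintype.mem_piFinset.1 ha i)
    have hanti : Antitone a := by
      intro i j hij
      rcases hij.eq_or_lt with rfl | hij
      · rfl
      · exact (ha j).2.trans ((lam.rowLen_anti (i + 1) j hij).trans (ha i).1)
    have hsub : YoungDiagram.ofFin a ≤ lam := by
      rintro ⟨i, j⟩ hc
      obtain ⟨hi, hj⟩ := (YoungDiagram.mem_ofFin hanti).1 hc
      exact YoungDiagram.mem_iff_lt_rowLen.2 (hj.trans_le (ha ⟨i, hi⟩).2)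
    have hstrip (i : ℕ) : lam.rowLen (i + 1) ≤ (YoungDiagram.ofFin a).rowLen i := by
      by_cases hi : i < n
      · exact (ha ⟨i, hi⟩).1.trans (YoungDiagram.rowLen_ofFin hanti ⟨i, hi⟩).ge
      · rw [YoungDiagram.rowLen_eq_zero_iff.2 (by omega)]
        exact Nat.zero_le _
    let T := U.extend n (fun c hc => hU c.1 c.2 ((YoungDiagram.mem_cells _).1 hc)) hsub hstrip
    have hT (i j) : T i j = open Classical in if (i, j) ∈ YoungDiagram.ofFin a then U i j
      else if (i, j) ∈ lam then n else 0 := rfl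
    have hshape : T.shapeLT n = YoungDiagram.ofFin a := by
      refine YoungDiagram.ext (Finset.ext fun ⟨i, j⟩ => ?_)
      rw [YoungDiagram.mem_cells, YoungDiagram.mem_cells, T.mem_shapeLT, hT]
      by_cases hc : (i, j) ∈ YoungDiagram.ofFin a
      · simp [hc, hsub hc, hU i j hc]
      · by_cases hc' : (i, j) ∈ lam <;> simp [hc, hc']
    refine ⟨T, mem_boundedTableaux_toFinset.2 fun i j hc => ?_,
      SemistandardYoungTableau.sigma_ext (F := YoungDiagram.ofFin) ?_ fun i j => ?_⟩
    · rw [hT]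
      split_ifs with h
      · exact (hU i j h).trans (Nat.lt_succ_self n)
      · exact Nat.lt_succ_self n
    · funext i
      dsimp only
      rw [hshape, YoungDiagram.rowLen_ofFin hanti]
    · dsimp only
      by_cases hc : (i, j) ∈ YoungDiagram.ofFin a
      · rw [T.restrictLT_apply _ (by rwa [T.ofFin_rowLen_shapeLT, hshape]), hT, if_pos hc]
      · rw [SemistandardYoungTableau.zeros _ hc, SemistandardYoungTableau.zeros]
        rwa [T.ofFin_rowLen_shapeLT, hshape]
  · intro T hT
    rw [mem_boundedTableaux_toFinset] at hT
    dsimp only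
    rw [Fin.prod_univ_castSucc, Finset.prod_pow_eq_pow_sum, ← pow_add, mul_comm, Fin.val_last,
      tableauWeight_last hlam hT fun i => hrow (T.shapeLT_le n) i]
    congr 1
    exact Finset.prod_congr rfl fun k _ => by
      rw [tableauWeight_restrictLT T k.2 _ (T.ofFin_rowLen_shapeLT n)]; rfl

/-- The plain geometric counterpart of `sum_gapWeight_mul_pow`; `l` is the staircase shift of the
exponents. -/
theorem sum_pow_sub_mul_pow (x z : R) (k l d : ℕ) :
    (∑ c ∈ Finset.Icc k (k + d), x ^ (k + d - c) * z ^ (c + l)) * (z - x) =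
      z ^ (k + d + (l + 1)) - x ^ (d + 1) * z ^ (k + l) := by
  have h : ∑ c ∈ Finset.Icc k (k + d), x ^ (k + d - c) * z ^ (c + l) =
      z ^ (k + l) * ∑ e ∈ Finset.range (d + 1), z ^ e * x ^ (d + 1 - 1 - e) := by
    rw [← Finset.Ico_add_one_right_eq_Icc, Finset.sum_Ico_eq_sum_range, Finset.mul_sum,
      show k + d + 1 - k = d + 1 by omega]
    refine Finset.sum_congr rfl fun e he => ?_
    rw [Finset.mem_range] at he
    rw [show k + d - (k + e) = d + 1 - 1 - e by omega]
    ring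
  rw [h, mul_assoc, sum_range_succ_mul_pow_mul_sub]
  ring

/-- The bialternant formula for Schur functions. -/
theorem altVandermonde_mul_schurFunction {n : ℕ} {lam : YoungDiagram} (hlam : lam.colLen 0 ≤ n)
    (x : Fin n → R) : altVandermonde x * schurFunction lam x =
      (Matrix.of fun i j : Fin n => x i ^ (lam.rowLen j + (n - 1 - j))).det := by
  induction n generalizing lam with
  | zero =>
    have hbot : ∀ i j, (i, j) ∉ lam := fun i j hc => by
      have := YoungDiagram.mem_iff_lt_colLen.1 (lam.up_left_mem le_rfl (Nat.zero_le j) hc)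
      omega
    have : (boundedTableaux_finite lam 0).toFinset = {.highestWeight lam} := by
      ext T
      rw [mem_boundedTableaux_toFinset, Finset.mem_singleton]
      refine ⟨fun _ => SemistandardYoungTableau.ext fun i j => ?_,
        fun _ i j hc => absurd hc (hbot i j)⟩
      rw [T.zeros (hbot i j), SemistandardYoungTableau.zeros _ (hbot i j)]
    simp [schurFunction, this, altVandermonde]
  | succ n ih =>
    have hb : Antitone fun j : Fin (n + 1) => lam.rowLen j + (n + 1 - 1 - j) := by
      intro i j hij
      have h1 := lam.rowLen_anti i j hij
      have h2 : (i : ℕ) ≤ j := hij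
      dsimp only
      omega
    -- Here `f = 1`, and the shift `n - 1 - j` makes all exponents strictly decreasing, so no terms
    -- need to be discarded.
    have key := prod_sub_mul_sum_det x _ hb
      (fun j : Fin n => Finset.Icc (lam.rowLen (j + 1)) (lam.rowLen j))
      (fun j c => x (Fin.last n) ^ (lam.rowLen j - c)) (fun j c => c + (n - 1 - j)) (fun _ => 1)
      (fun j z => by
        obtain ⟨d, hd⟩ := Nat.exists_eq_add_of_le (lam.rowLen_anti j (j + 1) (Nat.le_succ _))
        have h2 := j.2
        simp only [Fin.val_castSucc, Fin.val_succ]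
        rw [hd, sum_pow_sub_mul_pow, one_mul, show n + 1 - 1 - (j : ℕ) = n - 1 - j + 1 by omega,
          show n + 1 - 1 - ((j : ℕ) + 1) = n - 1 - j by omega, show lam.rowLen (j + 1) + d +
          (n - 1 - j + 1) - (lam.rowLen (j + 1) + (n - 1 - j)) = d + 1 by omega])
    rw [Finset.prod_const_one, one_mul] at key
    rw [← key, altVandermonde_succ, schurFunction_succ hlam, mul_assoc]
    congr 1
    rw [Finset.mul_sum]
    refine Finset.sum_congr rfl fun a ha => ?_
    have ha (i) := Finset.mem_Icc.1 (Fintype.mem_piFinset.1 ha i)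
    have hanti : Antitone a := by
      intro i j hij
      rcases hij.eq_or_lt with rfl | hij
      · rfl
      · exact (ha j).2.trans ((lam.rowLen_anti (i + 1) j hij).trans (ha i).1)
    rw [mul_left_comm, ih (YoungDiagram.colLen_ofFin_le a)]
    simp only [YoungDiagram.rowLen_ofFin hanti, Fin.val_last, Nat.add_sub_cancel, Nat.sub_self,
      Nat.add_zero]

/-! ### Specialisation from the generic case. -/

theorem map_schurFunction {S : Type*} [CommRing S] (f : R →+* S) (lam : YoungDiagram) {n : ℕ}
    (x : Fin n → R) : f (schurFunction lam x) = schurFunction lam fun i => f (x i) := by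
  simp [schurFunction, map_sum, map_prod]

theorem map_asmSum {S : Type*} [CommRing S] (f : R →+* S) {n : ℕ} (m : ℕ) (b : Fin n → ℕ)
    (x y : Fin n → R) :
    f (asmSum m b x y) = asmSum m b (fun i => f (x i)) fun i => f (y i) := by
  simp only [asmSum, map_sum, map_prod]
  refine Finset.sum_congr rfl fun A _ => Finset.prod_congr rfl fun k _ =>
    Finset.prod_congr rfl fun q _ => ?_
  cases compassMatrix A k q <;> simp [Compass.weight]

/-- In `R` the Vandermonde product may be a zero divisor, so it is cancelled in the domain of
integer polynomials in independent `X i`, `Y i`; evaluation transports the identity. -/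
theorem prod_add_mul_schurFunction_eq_asmSum {n m : ℕ} {lam : YoungDiagram}
    (hlam : lam.colLen 0 ≤ n) (hm : ∀ i : Fin n, lam.rowLen i + (n - 1 - i) < m)
    (x y : Fin n → R) :
    (∏ i : Fin n, ∏ j ∈ Finset.Ioi i, (x i + y j)) * schurFunction lam x =
      asmSum m (fun i : Fin n => lam.rowLen i + (n - 1 - i)) x y := by
  let X (i : Fin n) : MvPolynomial (Fin n ⊕ Fin n) ℤ := MvPolynomial.X (.inl i)
  let Y (i : Fin n) : MvPolynomial (Fin n ⊕ Fin n) ℤ := MvPolynomial.X (.inr i)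
  have hb : StrictAnti fun i : Fin n => lam.rowLen i + (n - 1 - i) := by
    intro i j hij
    have h1 := lam.rowLen_anti i j (Fin.le_def.1 hij.le)
    have h2 : (i : ℕ) < j := hij
    have h3 := j.2
    dsimp only
    omega
  have hX : Function.Injective X := (MvPolynomial.X_injective).comp Sum.inl_injective
  have key : (∏ i : Fin n, ∏ j ∈ Finset.Ioi i, (X i + Y j)) * schurFunction lam X =
      asmSum m (fun i : Fin n => lam.rowLen i + (n - 1 - i)) X Y := by
    refine mul_left_cancel₀ (altVandermonde_ne_zero hX) ?_
    rw [mul_left_comm, altVandermonde_mul_schurFunction hlam, altVandermonde_mul_asmSum hb hm]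
  have := congrArg (MvPolynomial.eval₂Hom (Int.castRingHom R) (Sum.elim x y)) key
  rw [map_mul, map_schurFunction, map_asmSum] at this
  simpa [X, Y, map_prod] using this

end Schur

theorem mainTheorem7 {R : Type*} [CommRing R] (n m : ℕ) (lam : YoungDiagram)
    (hlam : lam.colLen 0 ≤ n) (hm : ∀ i, shiftedParts lam n i ≤ m) (x y : Fin n → R) :
    (∏ i : Fin n, ∏ j ∈ Finset.Ioi i, (x i + y j)) * schurFunction lam x =
      ∑ A ∈ muASM m (shiftedParts lam n), ∏ k : Fin n,
        (x k ^ compassCount Compass.NE A k * y k ^ compassCount Compass.SE A k *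
          (x k + y k) ^ compassCount Compass.NS A k) := by
  -- The parts are column labels, one more than the zero-based indices used as exponents.
  have hmu : shiftedParts lam n = fun i : Fin n => lam.rowLen i + (n - 1 - i) + 1 := by
    funext i
    have := i.2
    rw [shiftedParts]
    omega
  rw [hmu] at hm ⊢
  rw [prod_add_mul_schurFunction_eq_asmSum hlam hm]
  simp_rw [prod_compass_weight]
  rfl
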